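/- Let $G$ be a plane graph (finite, simple, considered up to homeomorphism of the sphere, i.e. a connected graph with a rotation system of Euler genus $0$) each of whose faces, the outer one included, is bounded by a cycle of even length. A proper vertex coloring of $G$ is called half-monochromatic if, for every face $f$, half of the vertices incident with $f$ receive the same color. Let $\chi_f(G)$ be the largest $k$ for which $G$ has a half-monochromatic coloring that uses exactly $k$ colors. The medial graph $M(G)$ is the plane (multi)graph with one vertex $[e]$ at the midpoint of each edge $e$ of $G$ and, for each face $f$ of $G$ and any two edges $e,e'$ that are consecutive on the boundary of $f$ at a vertex $v$, one edge joining $[e]$ and $[e']$, drawn inside $f$ around the corner of $f$ at $v$. A dividing system of $G$ is a spanning subgraph of $M(G)$ that contains, inside each face of $G$ bounded by a cycle of length $2n$, exactly $n$ edges of $M(G)$, these forming a matching. Its regions are the regions into which it cuts the plane: the classes of faces of $M(G)$ obtained by joining two faces whenever they lie on the two sides of an edge of $M(G)$ not in the dividing system. Let $\lambda$ be the largest number of regions into which a dividing system of $G$ cuts the plane. Then both maxima exist, and $\chi_f(G)=\lambda$. -/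

import Mathlib

/-- A combinatorial map: a multigraph drawn on an oriented surface with all faces discs, encoded by
its darts (oriented edges). `rot d` is the next dart, counterclockwise, leaving the vertex that
`d` leaves, and `rev d` is the same edge with the opposite orientation. -/
structure CombMap (D : Type*) where
  rot : Equiv.Perm D
  rev : Equiv.Perm D
  rev_rev : ∀ d, rev (rev d) = d
  rev_ne : ∀ d, rev d ≠ d

namespace CombMap

variable {D : Type*} (M : CombMap D)

/-- The facial successor: walk along `d`, keeping the face on the left-hand side, and leave the
vertex reached by the next dart in clockwise order. -/
def facePerm : Equiv.Perm D := M.rot⁻¹ * M.rev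

/-- Vertices are the orbits of `rot`. -/
def Vertex : Type _ := Quotient (Equiv.Perm.SameCycle.setoid M.rot)

/-- Edges are the orbits of `rev`. -/
def Edge : Type _ := Quotient (Equiv.Perm.SameCycle.setoid M.rev)

/-- Faces are the orbits of `facePerm`. -/
def Face : Type _ := Quotient (Equiv.Perm.SameCycle.setoid M.facePerm)

/-- The vertex that the dart `d` leaves. -/
def vertex (d : D) : M.Vertex := Quotient.mk (Equiv.Perm.SameCycle.setoid M.rot) d

/-- The edge underlying the dart `d`. -/
def edge (d : D) : M.Edge := Quotient.mk (Equiv.Perm.SameCycle.setoid M.rev) d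

/-- The face on the left-hand side of the dart `d`. -/
def face (d : D) : M.Face := Quotient.mk (Equiv.Perm.SameCycle.setoid M.facePerm) d

/-- The set of endpoints of an edge. -/
def ends (e : M.Edge) : Set M.Vertex := {v | ∃ d, M.edge d = e ∧ M.vertex d = v}

/-- The regions into which the surface is cut by the spanning subgraph with edge set `S`:
erasing an edge that is not in `S` joins the faces on its two sides. -/
def Region (S : Set M.Edge) : Type _ :=
  Quot (fun F F' : M.Face => ∃ d, M.edge d ∉ S ∧ M.face d = F ∧ M.face (M.rev d) = F')

/-- The medial graph, drawn on the same surface. It has one vertex on each edge of `M`, and one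
edge in each corner of a face of `M`. The corner at the dart `d` lies, at the vertex that `d`
leaves, between `d` and `rot d`, in the face to the left of `d`. The medial edge in this corner
joins the edge of `d` to the edge of `rot d`; the dart `(d, false)` leaves the former and
`(d, true)` leaves the latter. Around the medial vertex on the edge of `d` one meets, in
counterclockwise order, the darts
`(d, false)`, `(rot⁻¹ d, true)`, `(rev d, false)`, `(rot⁻¹ (rev d), true)`. -/
def medial : CombMap (D × Bool) where
  rot :=
    { toFun := fun x => match x with
        | (d, false) => (M.rot.symm d, true)
        | (d, true) => (M.rev (M.rot d), false)
      invFun := fun x => match x with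
        | (d, false) => (M.rot.symm (M.rev d), true)
        | (d, true) => (M.rot d, false)
      left_inv := by rintro ⟨d, _ | _⟩ <;> simp [M.rev_rev]
      right_inv := by rintro ⟨d, _ | _⟩ <;> simp [M.rev_rev] }
  rev :=
    { toFun := fun x => (x.1, !x.2)
      invFun := fun x => (x.1, !x.2)
      left_inv := by rintro ⟨d, _ | _⟩ <;> rfl
      right_inv := by rintro ⟨d, _ | _⟩ <;> rfl }
  rev_rev := by rintro ⟨d, _ | _⟩ <;> rfl
  rev_ne := by rintro ⟨d, _ | _⟩ <;> simp

/-- The edges of the medial graph that are drawn inside the face `f`. -/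
def medialEdgesIn (f : M.Face) : Set M.medial.Edge :=
  {e | ∃ d, M.face d = f ∧ M.medial.edge (d, false) = e}

/-- A dividing system: a spanning subgraph of the medial graph (given by its set of edges) which
has, inside each face bounded by `2 n` darts, exactly `n` edges, and these form a matching. -/
def IsDividingSystem (S : Set M.medial.Edge) : Prop :=
  ∀ f : M.Face,
    2 * (S ∩ M.medialEdgesIn f).ncard = {d | M.face d = f}.ncard ∧
    ∀ e ∈ S ∩ M.medialEdgesIn f, ∀ e' ∈ S ∩ M.medialEdgesIn f, e ≠ e' →
      Disjoint (M.medial.ends e) (M.medial.ends e')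

end CombMap

/-- A connected plane graph with underlying simple graph `G`, up to homeomorphism: the
counterclockwise cyclic order of the darts at each vertex, such that the surface obtained by gluing
a disc to each facial walk has Euler characteristic two, that is, is the sphere (the plane with a
point at infinity in one of the faces). -/
structure PlaneGraph {V : Type*} (G : SimpleGraph V) where
  rot : Equiv.Perm G.Dart
  rot_fst : ∀ d, (rot d).fst = d.fst
  rot_cyclic : ∀ d d' : G.Dart, d.fst = d'.fst → rot.SameCycle d d'
  connected : G.Connected
  euler : Nat.card V +
    Nat.card (CombMap.Face
      { rot := rot
        rev := SimpleGraph.Dart.symm_involutive.toPerm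
        rev_rev := SimpleGraph.Dart.symm_symm
        rev_ne := SimpleGraph.Dart.symm_ne }) = Nat.card G.edgeSet + 2

namespace PlaneGraph

variable {V : Type*} {G : SimpleGraph V} (P : PlaneGraph G)

/-- The combinatorial map of a plane graph. -/
def toMap : CombMap G.Dart where
  rot := P.rot
  rev := SimpleGraph.Dart.symm_involutive.toPerm
  rev_rev := SimpleGraph.Dart.symm_symm
  rev_ne := SimpleGraph.Dart.symm_ne

/-- Each face is bounded by a cycle of even length. -/
def HasEvenPolygonalFaces : Prop :=
  ∀ f : P.toMap.Face, ∃ (v : V) (c : G.Walk v v), c.IsCycle ∧ Even c.length ∧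
    ∀ d : G.Dart, d ∈ c.darts ↔ P.toMap.face d = f

/-- The vertices incident with a face. -/
def faceVertices (f : P.toMap.Face) : Set V := {v | ∃ d, P.toMap.face d = f ∧ d.fst = v}

/-- A proper colouring is half-monochromatic if, for every face, half of the vertices incident
with that face receive the same colour. -/
def IsHalfMonochromatic {α : Type*} (C : G.Coloring α) : Prop :=
  ∀ f : P.toMap.Face, ∃ a : α,
    2 * {v | v ∈ P.faceVertices f ∧ C v = a}.ncard = (P.faceVertices f).ncard

/-- The numbers `k` such that there is a half-monochromatic colouring with exactly `k` colours,
all of which are used. -/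
def halfMonochromaticNumbers : Set ℕ :=
  {k | ∃ C : G.Coloring (Fin k), Function.Surjective C ∧ P.IsHalfMonochromatic C}

/-- The largest number of colours of a half-monochromatic colouring. -/
noncomputable def chiF : ℕ := sSup P.halfMonochromaticNumbers

/-- The numbers of regions into which dividing systems cut the plane. -/
def dividingRegionNumbers : Set ℕ :=
  {r | ∃ S : Set P.toMap.medial.Edge, P.toMap.IsDividingSystem S ∧
    Nat.card (P.toMap.medial.Region S) = r}

/-- The largest number of regions into which a dividing system cuts the plane. -/
noncomputable def maxRegions : ℕ := sSup P.dividingRegionNumbers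

end PlaneGraph

/-! A medial edge is a corner of a face, and half of the corners of a face form a matching exactly
when they alternate along it. Dividing systems and half-monochromatic colourings are thus both
alternating patterns on faces.

The faces of the medial graph are one around each vertex and one in the middle of each face of `G`;
a corner outside `S` joins the two that meet there. Given a dividing system, colour each vertex by
its region. Every region contains a vertex, and the middle of a face is joined to every other vertex
of that face. The colouring is proper because `G` is bipartite and each region meets only one class.
So every number of regions is a number of colours (`dividingRegionNumbers_subset`).

Conversely, given a colouring, cut off in each face the corners that lack its half-majority colour.
Each resulting region is monochromatic, so there are at least as many regions as colours
(`exists_le_dividingRegionNumbers`). Bipartiteness comes from Euler's formula and linear algebra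
modulo two (`nonempty_coloring_bool`). -/

/-! ### Alternating sets along a permutation. -/

theorem Equiv.Perm.SameCycle.apply_eq_of_invariant {α β : Type*} {f : Equiv.Perm α} {g : α → β}
    (h : ∀ x, g (f x) = g x) {x y : α} (hxy : f.SameCycle x y) : g x = g y := by
  obtain ⟨n, rfl⟩ := hxy
  induction n using Int.induction_on with
  | zero => simp
  | succ n ih => rw [add_comm, zpow_add, Equiv.Perm.mul_apply, zpow_one, h, ih]
  | pred n ih =>
    rw [ih, ← h ((f ^ (-(n : ℤ) - 1)) x), ← Equiv.Perm.mul_apply, ← zpow_one_add]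
    congr 3
    ring

/-- A subset of an invariant set that has half of its elements and is disjoint from its image
alternates along the permutation. -/
theorem Equiv.Perm.mem_iff_notMem_of_ncard {D : Type*} [Finite D] (φ : Equiv.Perm D)
    {F A : Set D} (hF : ∀ d, φ d ∈ F ↔ d ∈ F) (hAF : A ⊆ F) (hA : ∀ d ∈ A, φ d ∉ A)
    (hcard : 2 * A.ncard = F.ncard) {d : D} (hd : d ∈ F) : φ d ∈ A ↔ d ∉ A := by
  refine ⟨fun h h' => hA d h' h, fun h => ?_⟩
  have hdisj : _root_.Disjoint (φ '' A) A := by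
    rw [Set.disjoint_left]
    rintro _ ⟨x, hx, rfl⟩
    exact hA x hx
  have hsub : φ '' A ∪ A ⊆ F := by
    rintro x (⟨y, hy, rfl⟩ | hx)
    · exact (hF y).2 (hAF hy)
    · exact hAF hx
  -- Two disjoint copies of half of `F` fill it.
  have heq : φ '' A ∪ A = F := by
    refine Set.eq_of_subset_of_ncard_le hsub ?_ (Set.toFinite _)
    rw [Set.ncard_union_eq hdisj (Set.toFinite _) (Set.toFinite _),
      Set.ncard_image_of_injective _ φ.injective]
    omega
  have hmem : φ d ∈ φ '' A ∪ A := by rw [heq]; exact (hF d).2 hd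
  rcases hmem with ⟨y, hy, hyd⟩ | hmem
  · exact absurd (φ.injective hyd ▸ hy) h
  · exact hmem

/-- An alternating subset of an invariant set has half of its elements. -/
theorem Equiv.Perm.two_mul_ncard_of_alternating {D : Type*} [Finite D] (φ : Equiv.Perm D)
    {F A : Set D} (hF : ∀ d, φ d ∈ F ↔ d ∈ F) (hAF : A ⊆ F)
    (hA : ∀ d ∈ F, (φ d ∈ A ↔ d ∉ A)) : 2 * A.ncard = F.ncard := by
  have himage : φ '' A = F \ A := by
    ext x
    constructor
    · rintro ⟨y, hy, rfl⟩
      exact ⟨(hF y).2 (hAF hy), fun h => (hA y (hAF hy)).1 h hy⟩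
    · rintro ⟨hx, hxA⟩
      refine ⟨φ.symm x, ?_, by simp⟩
      by_contra h
      have hxF : φ.symm x ∈ F := by rw [← hF]; simpa using hx
      exact hxA (by simpa using (hA _ hxF).2 h)
  have h1 := Set.ncard_image_of_injective A φ.injective
  have h2 := Set.ncard_sdiff_add_ncard_of_subset hAF (Set.toFinite _)
  rw [himage] at h1
  omega

/-! ### Corners, dividing systems and regions of the medial graph. -/

namespace CombMap

variable {D : Type*} (M : CombMap D)

theorem face_eq_iff {d d' : D} : M.face d = M.face d' ↔ M.facePerm.SameCycle d d' :=
  Quotient.eq (r := Equiv.Perm.SameCycle.setoid M.facePerm)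

theorem edge_eq_iff {d d' : D} : M.edge d = M.edge d' ↔ M.rev.SameCycle d d' :=
  Quotient.eq (r := Equiv.Perm.SameCycle.setoid M.rev)

theorem vertex_eq_iff {d d' : D} : M.vertex d = M.vertex d' ↔ M.rot.SameCycle d d' :=
  Quotient.eq (r := Equiv.Perm.SameCycle.setoid M.rot)

theorem face_surjective : Function.Surjective M.face := Quotient.mk_surjective

@[simp] theorem face_facePerm (d : D) : M.face (M.facePerm d) = M.face d :=
  M.face_eq_iff.2 (Equiv.Perm.sameCycle_apply_left.2 (Equiv.Perm.SameCycle.refl _ _))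

@[simp] theorem edge_rev (d : D) : M.edge (M.rev d) = M.edge d :=
  M.edge_eq_iff.2 (Equiv.Perm.sameCycle_apply_left.2 (Equiv.Perm.SameCycle.refl _ _))

@[simp] theorem vertex_rot (d : D) : M.vertex (M.rot d) = M.vertex d :=
  M.vertex_eq_iff.2 (Equiv.Perm.sameCycle_apply_left.2 (Equiv.Perm.SameCycle.refl _ _))

theorem rot_facePerm (d : D) : M.rot (M.facePerm d) = M.rev d := by
  simp [facePerm]

theorem medial_edge_true (d : D) : M.medial.edge (d, true) = M.medial.edge (d, false) :=
  M.medial.edge_rev (d, false)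

theorem medial_edge_eq (x : D × Bool) : M.medial.edge x = M.medial.edge (x.1, false) := by
  obtain ⟨d, _ | _⟩ := x
  · rfl
  · exact M.medial_edge_true d

theorem fst_eq_of_medial_edge_eq {x y : D × Bool} (h : M.medial.edge x = M.medial.edge y) :
    x.1 = y.1 :=
  (M.medial.edge_eq_iff.1 h).apply_eq_of_invariant (g := Prod.fst) fun _ => rfl

theorem medial_edge_false_injective :
    Function.Injective fun d => M.medial.edge (d, false) :=
  fun _ _ h => M.fst_eq_of_medial_edge_eq h

theorem ncard_inter_medialEdgesIn (S : Set M.medial.Edge) (f : M.Face) :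
    (S ∩ M.medialEdgesIn f).ncard =
      {d | M.face d = f ∧ M.medial.edge (d, false) ∈ S}.ncard := by
  rw [← Set.ncard_image_of_injective _ M.medial_edge_false_injective]
  congr 1
  ext e
  constructor
  · rintro ⟨he, d, hd, rfl⟩
    exact ⟨d, ⟨hd, he⟩, rfl⟩
  · rintro ⟨d, ⟨hd, he⟩, rfl⟩
    exact ⟨he, d, hd, rfl⟩

theorem medial_vertex_true_facePerm (d : D) :
    M.medial.vertex (M.facePerm d, true) = M.medial.vertex (d, false) := by
  have h : M.medial.rot (M.facePerm d, true) = (d, false) := by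
    change (M.rev (M.rot (M.facePerm d)), false) = (d, false)
    rw [rot_facePerm, M.rev_rev]
  rw [← M.medial.vertex_rot, h]

/-- Consecutive corners of a face share a vertex of the medial graph. -/
theorem not_disjoint_medial_ends (d : D) :
    ¬ Disjoint (M.medial.ends (M.medial.edge (d, false)))
      (M.medial.ends (M.medial.edge (M.facePerm d, false))) := by
  rw [Set.not_disjoint_iff]
  exact ⟨M.medial.vertex (d, false), ⟨_, rfl, rfl⟩,
    ⟨_, M.medial_edge_true _, M.medial_vertex_true_facePerm d⟩⟩

/-- The edge on which a vertex of the medial graph lies. -/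
theorem edge_eq_of_medial_vertex_eq {x y : D × Bool}
    (h : M.medial.vertex x = M.medial.vertex y) :
    M.edge (cond x.2 (M.rot x.1) x.1) = M.edge (cond y.2 (M.rot y.1) y.1) := by
  refine (M.medial.vertex_eq_iff.1 h).apply_eq_of_invariant
    (g := fun x : D × Bool => M.edge (cond x.2 (M.rot x.1) x.1)) ?_
  rintro ⟨d, _ | _⟩
  · change M.edge (M.rot (M.rot.symm d)) = M.edge d
    simp
  · exact M.edge_rev _

variable {M} in
/-- In each face, the corners that belong to a dividing system alternate with the others. -/
theorem IsDividingSystem.mem_facePerm_iff [Finite D] {S : Set M.medial.Edge}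
    (hS : M.IsDividingSystem S) (hM : ∀ d, M.facePerm d ≠ d) (d : D) :
    M.medial.edge (M.facePerm d, false) ∈ S ↔ M.medial.edge (d, false) ∉ S := by
  have key := M.facePerm.mem_iff_notMem_of_ncard (F := {x | M.face x = M.face d})
    (A := {x | M.face x = M.face d ∧ M.medial.edge (x, false) ∈ S}) (by simp)
    (fun x hx => hx.1) ?_ ?_ (d := d) rfl
  · simpa using key
  · rintro x ⟨hx, hxS⟩ ⟨hx', hxS'⟩
    refine M.not_disjoint_medial_ends x ((hS (M.face d)).2 _ ⟨hxS, x, hx, rfl⟩ _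
      ⟨hxS', _, hx', rfl⟩ fun h => hM x ?_)
    exact (M.medial_edge_false_injective h).symm
  · rw [← ncard_inter_medialEdgesIn]
    exact (hS _).1

/-- A set of corners that alternate along each face is a dividing system, provided that no face
meets an edge from both sides. -/
theorem isDividingSystem_of_alternating [Finite D] {S : Set M.medial.Edge}
    (hM : ∀ d d', M.face d = M.face d' → M.edge d = M.edge d' → d = d')
    (hS : ∀ d, M.medial.edge (M.facePerm d, false) ∈ S ↔ M.medial.edge (d, false) ∉ S) :
    M.IsDividingSystem S := by
  intro f
  constructor
  · rw [ncard_inter_medialEdgesIn]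
    refine M.facePerm.two_mul_ncard_of_alternating (by simp) (fun x hx => hx.1) ?_
    rintro d rfl
    simpa using hS d
  · rintro _ ⟨hdS, d, rfl, rfl⟩ _ ⟨hdS', d', hd', rfl⟩ hne
    rw [Set.disjoint_left]
    rintro _ ⟨x, hx, rfl⟩ ⟨y, hy, hxy⟩
    have hx1 := M.fst_eq_of_medial_edge_eq hx
    have hy1 := M.fst_eq_of_medial_edge_eq hy
    have hedge := M.edge_eq_of_medial_vertex_eq hxy
    obtain ⟨x, i⟩ := x
    obtain ⟨y, j⟩ := y
    dsimp only at hx1 hy1 hedge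
    subst hx1 hy1
    -- The corner at `z` ends on the edges of `z` and of its predecessor along the face. By `hM`, a
    -- shared end then makes the two corners equal (ends of the same kind) or consecutive (ends of
    -- different kinds).
    have hrot : ∀ z, M.edge (M.rot z) = M.edge (M.facePerm.symm z) := fun z => by
      rw [← M.edge_rev (M.facePerm.symm z), ← rot_facePerm, Equiv.apply_symm_apply]
    have hface : ∀ z, M.face (M.facePerm.symm z) = M.face z := fun z => by
      rw [← M.face_facePerm, Equiv.apply_symm_apply]
    have hS' : ∀ z, M.medial.edge (M.facePerm.symm z, false) ∈ S →
        M.medial.edge (z, false) ∉ S := fun z h h' => by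
      rw [← M.facePerm.apply_symm_apply z] at h'
      exact (hS _).1 h' h
    cases i <;> cases j <;> simp only [cond_true, cond_false, hrot] at hedge
    · exact hne (by rw [hM _ _ hd' hedge])
    · have := hM _ _ ((hface y).trans hd') hedge
      rw [← this] at hdS
      exact hS' _ hdS hdS'
    · have := hM _ _ (hd'.trans (hface x).symm) hedge
      rw [this] at hdS'
      exact hS' _ hdS' hdS
    · have := hM _ _ ((hface y).trans (hd'.trans (hface x).symm)) hedge
      exact hne (by rw [M.facePerm.symm.injective this])

/-- Two functions on darts, one constant around vertices and the other one constant around faces,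
which agree at the corners that do not belong to `S`, define a function on the regions of `S`. -/
def regionLift {α : Type*} (S : Set M.medial.Edge) (p q : D → α) (hp : ∀ d, p (M.rot d) = p d)
    (hq : ∀ d, q (M.facePerm d) = q d) (h : ∀ d, M.medial.edge (d, false) ∉ S → p d = q d) :
    M.medial.Region S → α :=
  Quot.lift
    (Quotient.lift (s := Equiv.Perm.SameCycle.setoid M.medial.facePerm)
      (fun x : D × Bool => cond x.2 (q x.1) (p x.1)) fun x y hxy => by
        refine Equiv.Perm.SameCycle.apply_eq_of_invariant (f := M.medial.facePerm)
          (g := fun x : D × Bool => cond x.2 (q x.1) (p x.1)) ?_ hxy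
        -- The medial face permutation sends `(d, false)` to `(rot d, false)`, circling a vertex,
        -- and `(d, true)` to `(facePerm d, true)`, running along the inside of a face.
        rintro ⟨d, _ | _⟩
        · exact hp d
        · exact hq d)
    (by
      rintro _ _ ⟨⟨d, b⟩, hx, rfl, rfl⟩
      rw [medial_edge_eq] at hx
      cases b
      · exact h d hx
      · exact (h d hx).symm)

/-- The region that contains the face of the medial graph to the left of the dart `x`. -/
def region (S : Set M.medial.Edge) (x : D × Bool) : M.medial.Region S :=
  Quot.mk _ (M.medial.face x)

theorem region_surjective (S : Set M.medial.Edge) : Function.Surjective (M.region S) :=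
  Quot.mk_surjective.comp M.medial.face_surjective

theorem region_facePerm (S : Set M.medial.Edge) (x : D × Bool) :
    M.region S (M.medial.facePerm x) = M.region S x :=
  congrArg (Quot.mk _) (M.medial.face_facePerm x)

theorem region_false_eq_true {S : Set M.medial.Edge} {d : D}
    (h : M.medial.edge (d, false) ∉ S) : M.region S (d, false) = M.region S (d, true) :=
  Quot.sound ⟨(d, false), h, rfl, rfl⟩

end CombMap

/-! ### From dividing systems to colourings and back. -/

namespace PlaneGraph

variable {V : Type*} {G : SimpleGraph V} (P : PlaneGraph G)

theorem facePerm_fst (d : G.Dart) : (P.toMap.facePerm d).fst = d.snd := by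
  rw [← P.rot_fst]
  exact congrArg (fun d : G.Dart => d.fst) (P.toMap.rot_facePerm d)

theorem facePerm_ne (d : G.Dart) : P.toMap.facePerm d ≠ d := fun h =>
  d.adj.ne (by rw [← P.facePerm_fst d, h])

theorem edge_toMap {d d' : G.Dart} (h : P.toMap.edge d = P.toMap.edge d') : d.edge = d'.edge :=
  (P.toMap.edge_eq_iff.1 h).apply_eq_of_invariant (g := fun d : G.Dart => d.edge)
    SimpleGraph.Dart.edge_symm

instance [Finite V] : Finite G.Dart := by
  classical
  have := Fintype.ofFinite V
  infer_instance

instance [Finite V] : Finite P.toMap.Face :=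
  Finite.of_surjective _ P.toMap.face_surjective

instance [Finite V] (S : Set P.toMap.medial.Edge) : Finite (P.toMap.medial.Region S) :=
  Finite.of_surjective _ (P.toMap.region_surjective S)

/-- An isolated vertex would be the whole connected graph. With no darts there are no faces either,
against Euler's formula. -/
theorem exists_dart [Finite V] (P : PlaneGraph G) (v : V) : ∃ d : G.Dart, d.fst = v := by
  by_contra! h
  have hv : ∀ w, w = v := fun w => by
    obtain ⟨p⟩ := P.connected.preconnected v w
    cases p with
    | nil => rfl
    | cons hvw _ => exact absurd rfl (h ⟨(_, _), hvw⟩)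
  have hD : IsEmpty G.Dart := ⟨fun d => h d (hv _)⟩
  have hF : IsEmpty P.toMap.Face := P.toMap.face_surjective.isEmpty
  have hV : Subsingleton V := ⟨fun a b => (hv a).trans (hv b).symm⟩
  have h1 : Nat.card V ≤ 1 := Finite.card_le_one_iff_subsingleton.2 hV
  have h2 : Nat.card P.toMap.Face = 0 := Nat.card_of_isEmpty
  have h3 : Nat.card V + Nat.card P.toMap.Face = Nat.card G.edgeSet + 2 := P.euler
  omega

variable {P} in
theorem HasEvenPolygonalFaces.even_ncard (hP : P.HasEvenPolygonalFaces) (f : P.toMap.Face) :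
    Even {d | P.toMap.face d = f}.ncard := by
  classical
  obtain ⟨v, c, hc, heven, hmem⟩ := hP f
  have hset : {d | P.toMap.face d = f} = c.darts.toFinset := by
    ext d
    simp [hmem]
  rw [hset, Set.ncard_coe_finset, List.toFinset_card_of_nodup, c.length_darts]
  · exact heven
  · exact List.Nodup.of_map _ hc.edges_nodup

variable {P} in
theorem HasEvenPolygonalFaces.eq_of_edge_eq (hP : P.HasEvenPolygonalFaces) {d d' : G.Dart}
    (hf : P.toMap.face d = P.toMap.face d') (h : d.edge = d'.edge) : d = d' := by
  obtain ⟨v, c, hc, -, hmem⟩ := hP (P.toMap.face d')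
  exact List.inj_on_of_nodup_map hc.edges_nodup ((hmem d).2 hf) ((hmem d').2 rfl) h

variable {P} in
theorem HasEvenPolygonalFaces.eq_of_fst_eq (hP : P.HasEvenPolygonalFaces) {d d' : G.Dart}
    (hf : P.toMap.face d = P.toMap.face d') (h : d.fst = d'.fst) : d = d' := by
  obtain ⟨v, c, hc, -, hmem⟩ := hP (P.toMap.face d')
  have hnodup : (c.darts.map fun d => d.fst).Nodup := by
    rw [c.map_fst_darts]
    exact hc.nodup_dropLast_support
  exact List.inj_on_of_nodup_map hnodup ((hmem d).2 hf) ((hmem d').2 rfl) h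

-- A boundary cycle leaves each of its vertices by one dart, so vertices of a face can be counted by
-- darts, on which `facePerm` acts.
variable {P} in
theorem HasEvenPolygonalFaces.ncard_faceVertices (hP : P.HasEvenPolygonalFaces)
    (f : P.toMap.Face) (p : V → Prop) :
    {v | v ∈ P.faceVertices f ∧ p v}.ncard = {d | P.toMap.face d = f ∧ p d.fst}.ncard := by
  have himage : {v | v ∈ P.faceVertices f ∧ p v} =
      (fun d : G.Dart => d.fst) '' {d | P.toMap.face d = f ∧ p d.fst} := by
    ext v
    constructor
    · rintro ⟨⟨d, hd, rfl⟩, hp⟩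
      exact ⟨d, ⟨hd, hp⟩, rfl⟩
    · rintro ⟨d, ⟨hd, hp⟩, rfl⟩
      exact ⟨⟨d, hd, rfl⟩, hp⟩
  rw [himage, Set.InjOn.ncard_image]
  rintro d ⟨hd, -⟩ d' ⟨hd', -⟩ h
  exact hP.eq_of_fst_eq (hd.trans hd'.symm) h

variable {P} in
/-- A proper colouring is half-monochromatic if each face has a colour that appears at every other
vertex. -/
theorem HasEvenPolygonalFaces.isHalfMonochromatic_iff [Finite V] (hP : P.HasEvenPolygonalFaces)
    {α : Type*} (C : G.Coloring α) :
    P.IsHalfMonochromatic C ↔ ∀ f, ∃ a, ∀ d, P.toMap.face d = f → (C d.snd = a ↔ C d.fst ≠ a) := by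
  refine forall_congr' fun f => exists_congr fun a => ?_
  have h2 := hP.ncard_faceVertices f fun _ => True
  simp only [and_true, Set.ofPred_mem_eq] at h2
  rw [hP.ncard_faceVertices, h2]
  constructor
  · intro h d hd
    have key := P.toMap.facePerm.mem_iff_notMem_of_ncard (F := {d | P.toMap.face d = f})
      (A := {d | P.toMap.face d = f ∧ C d.fst = a}) (by simp) (fun x hx => hx.1) ?_ h (d := d) hd
    · simpa [hd, facePerm_fst] using key
    · rintro x ⟨-, hx⟩ ⟨-, hx'⟩
      rw [facePerm_fst] at hx'
      exact C.valid x.adj (hx.trans hx'.symm)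
  · intro h
    refine P.toMap.facePerm.two_mul_ncard_of_alternating (by simp) (fun x hx => hx.1) ?_
    intro d hd
    have hd' : P.toMap.face d = f := hd
    simpa [hd', facePerm_fst] using h d hd

variable {P} in
/-- The regions of a dividing system are the colours of a half-monochromatic colouring. -/
theorem HasEvenPolygonalFaces.dividingRegionNumbers_subset [Finite V]
    (hP : P.HasEvenPolygonalFaces) (β : G.Coloring Bool) :
    P.dividingRegionNumbers ⊆ P.halfMonochromaticNumbers := by
  classical
  rintro _ ⟨S, hS, rfl⟩
  have halt := hS.mem_facePerm_iff P.facePerm_ne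
  have hβ : ∀ d : G.Dart, β d.snd = !β d.fst := fun d =>
    Bool.eq_not.2 (β.valid d.adj).symm
  -- Both `β` and membership in `S` alternate along a face, so `q` is constant there. It extends `β`
  -- to a function `g` on regions, so no region meets both classes.
  let q : G.Dart → Bool := fun d =>
    if P.toMap.medial.edge (d, false) ∈ S then !β d.fst else β d.fst
  let g : P.toMap.medial.Region S → Bool := P.toMap.regionLift S (fun d => β d.fst) q
    (fun d => congrArg β (P.rot_fst d))
    (fun d => by
      simp only [q, halt, facePerm_fst, hβ]
      split_ifs <;> simp_all)
    (fun d hd => by simp [q, hd])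
  choose dart hdart using P.exists_dart
  let c : V → P.toMap.medial.Region S := fun v => P.toMap.region S (dart v, false)
  have hc : ∀ d : G.Dart, c d.fst = P.toMap.region S (d, false) := fun d =>
    (P.rot_cyclic (dart d.fst) d (hdart _)).apply_eq_of_invariant
      (g := fun d => P.toMap.region S (d, false))
      fun d => P.toMap.region_facePerm S (d, false)
  have hgc : ∀ v, g (c v) = β v := fun v => congrArg β (hdart v)
  let C : G.Coloring (P.toMap.medial.Region S) := SimpleGraph.Coloring.mk c fun {v w} hvw h =>
    β.valid hvw (by rw [← hgc, ← hgc, h])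
  have hC : Function.Surjective C := by
    intro r
    obtain ⟨⟨d, b⟩, rfl⟩ := P.toMap.region_surjective S r
    cases b
    · exact ⟨_, hc d⟩
    -- Of two consecutive corners one is outside `S`; through it the middle of the face reaches a
    -- vertex.
    · by_cases hd : P.toMap.medial.edge (d, false) ∈ S
      · refine ⟨_, (hc (P.toMap.facePerm d)).trans ?_⟩
        rw [P.toMap.region_false_eq_true (by rw [halt]; exact not_not.2 hd)]
        exact P.toMap.region_facePerm S (d, true)
      · exact ⟨_, (hc d).trans (P.toMap.region_false_eq_true hd)⟩
  have hhalf : P.IsHalfMonochromatic C := by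
    rw [hP.isHalfMonochromatic_iff]
    intro f
    obtain ⟨d₀, rfl⟩ := P.toMap.face_surjective f
    refine ⟨P.toMap.region S (d₀, true), fun d hd => ?_⟩
    have hreg : P.toMap.region S (d₀, true) = P.toMap.region S (d, true) :=
      (P.toMap.face_eq_iff.1 hd.symm).apply_eq_of_invariant
        (g := fun d => P.toMap.region S (d, true))
        fun d => P.toMap.region_facePerm S (d, true)
    have hiff : ∀ x : G.Dart, C x.fst = P.toMap.region S (x, true) ↔
        P.toMap.medial.edge (x, false) ∉ S := by
      -- At a corner in `S`, `g` takes opposite values on the two sides, so they cannot be connected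
      -- elsewhere.
      refine fun x => ⟨fun h hx => ?_, fun hx => (hc x).trans (P.toMap.region_false_eq_true hx)⟩
      have h1 := congrArg g ((hc x).symm.trans h)
      change β x.fst = q x at h1
      simp [q, hx] at h1
    have hnext := hiff (P.toMap.facePerm d)
    rw [halt, facePerm_fst] at hnext
    rw [hreg, Ne, hiff d, ← hnext]
    exact Eq.congr_right (P.toMap.region_facePerm S (d, true)).symm
  let e : P.toMap.medial.Region S ≃ Fin (Nat.card (P.toMap.medial.Region S)) := Finite.equivFin _
  let C' : G.Coloring (Fin (Nat.card (P.toMap.medial.Region S))) :=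
    SimpleGraph.Coloring.mk (fun v => e (C v)) fun hvw h => C.valid hvw (e.injective h)
  refine ⟨C', e.surjective.comp hC, (hP.isHalfMonochromatic_iff C').2 fun f => ?_⟩
  obtain ⟨a, ha⟩ := (hP.isHalfMonochromatic_iff C).1 hhalf f
  refine ⟨e a, fun d hd => ?_⟩
  change e (C d.snd) = e a ↔ e (C d.fst) ≠ e a
  rw [Ne, e.apply_eq_iff_eq, e.apply_eq_iff_eq]
  exact ha d hd

variable {P} in
/-- The colours of a half-monochromatic colouring are separated by a dividing system. -/
theorem HasEvenPolygonalFaces.exists_le_dividingRegionNumbers [Finite V]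
    (hP : P.HasEvenPolygonalFaces) {k : ℕ} (hk : k ∈ P.halfMonochromaticNumbers) :
    ∃ r ∈ P.dividingRegionNumbers, k ≤ r := by
  obtain ⟨C, hC, hhalf⟩ := hk
  rw [hP.isHalfMonochromatic_iff] at hhalf
  choose a ha using hhalf
  let S : Set P.toMap.medial.Edge :=
    {e | ∃ d : G.Dart, C d.fst ≠ a (P.toMap.face d) ∧ P.toMap.medial.edge (d, false) = e}
  have hS : ∀ d : G.Dart, P.toMap.medial.edge (d, false) ∈ S ↔ C d.fst ≠ a (P.toMap.face d) := by
    refine fun d => ⟨?_, fun h => ⟨d, h, rfl⟩⟩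
    rintro ⟨x, hx, hxd⟩
    rwa [P.toMap.medial_edge_false_injective hxd] at hx
  refine ⟨_, ⟨S, CombMap.isDividingSystem_of_alternating _
    (fun d d' hf h => hP.eq_of_edge_eq hf (P.edge_toMap h)) fun d => ?_, rfl⟩, ?_⟩
  · rw [hS, hS, facePerm_fst, CombMap.face_facePerm, Ne, ha _ d rfl]
  -- An uncut corner has the colour chosen for its face, so the colour is well defined on regions.
  · let h : P.toMap.medial.Region S → Fin k :=
      P.toMap.regionLift S (fun d => C d.fst) (fun d => a (P.toMap.face d))
        (fun d => congrArg C (P.rot_fst d)) (fun d => by simp)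
        (fun d hd => by simpa [hS] using hd)
    have hh : Function.Surjective h := fun i => by
      obtain ⟨v, rfl⟩ := hC i
      obtain ⟨d, rfl⟩ := P.exists_dart v
      exact ⟨P.toMap.region S (d, false), rfl⟩
    simpa using Nat.card_le_card_of_surjective h hh

theorem bddAbove_halfMonochromaticNumbers [Finite V] : BddAbove P.halfMonochromaticNumbers := by
  refine ⟨Nat.card V, ?_⟩
  rintro k ⟨C, hC, -⟩
  simpa using Nat.card_le_card_of_surjective C hC

variable {P} in
theorem HasEvenPolygonalFaces.two_mem_halfMonochromaticNumbers [Finite V]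
    (hP : P.HasEvenPolygonalFaces) (β : G.Coloring Bool) : 2 ∈ P.halfMonochromaticNumbers := by
  let e : Bool ≃ Fin 2 := finTwoEquiv.symm
  let C : G.Coloring (Fin 2) :=
    SimpleGraph.Coloring.mk (fun v => e (β v)) fun hvw h => β.valid hvw (e.injective h)
  have hC : ∀ d : G.Dart, C d.fst ≠ C d.snd := fun d => C.valid d.adj
  refine ⟨C, fun i => ?_, (hP.isHalfMonochromatic_iff C).2 fun f => ⟨0, fun d _ => ?_⟩⟩
  · obtain ⟨v⟩ := P.connected.nonempty
    obtain ⟨d, -⟩ := P.exists_dart v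
    have := hC d
    by_cases h : C d.fst = i
    · exact ⟨_, h⟩
    · exact ⟨d.snd, by omega⟩
  · have := hC d
    omega

end PlaneGraph

/-! ### Bipartiteness by linear algebra modulo two. -/

/-- The number, modulo two, of elements with given images under two maps. -/
def incidenceMatrix {D I J : Type*} [Fintype D] [DecidableEq I] [DecidableEq J]
    (p : D → I) (q : D → J) : Matrix I J (ZMod 2) :=
  Matrix.of fun i j => ∑ d, if p d = i ∧ q d = j then 1 else 0

theorem incidenceMatrix_transpose {D I J : Type*} [Fintype D] [DecidableEq I] [DecidableEq J]
    (p : D → I) (q : D → J) : (incidenceMatrix p q).transpose = incidenceMatrix q p := by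
  ext i j
  simp [incidenceMatrix, and_comm]

theorem incidenceMatrix_mulVec {D I J : Type*} [Fintype D] [Fintype J] [DecidableEq I]
    [DecidableEq J] (p : D → I) (q : D → J) (y : J → ZMod 2) (i : I) :
    (incidenceMatrix p q).mulVec y i = ∑ d, if p d = i then y (q d) else 0 := by
  simp only [incidenceMatrix, Matrix.mulVec, dotProduct, Matrix.of_apply, Finset.sum_mul]
  rw [Finset.sum_comm]
  refine Finset.sum_congr rfl fun d _ => ?_
  by_cases h : p d = i <;> simp [h]

theorem Matrix.rank_add_finrank_ker_mulVecLin {K I J : Type*} [Field K] [Fintype J]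
    (A : Matrix I J K) :
    A.rank + Module.finrank K (LinearMap.ker A.mulVecLin) = Fintype.card J := by
  rw [Matrix.rank, LinearMap.finrank_range_add_finrank_ker, Module.finrank_fintype_fun_eq_card]

theorem finrank_le_one_of_forall_const {K I : Type*} [Field K] {W : Submodule K (I → K)}
    (h : ∀ w ∈ W, ∀ i j, w i = w j) : Module.finrank K W ≤ 1 := by
  have : W ≤ Submodule.span K {fun _ => 1} := by
    intro w hw
    rw [Submodule.mem_span_singleton]
    by_cases hI : Nonempty I
    · obtain ⟨i⟩ := hI
      exact ⟨w i, funext fun j => by simp [h w hw i j]⟩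
    · exact ⟨0, funext fun j => absurd ⟨j⟩ hI⟩
  exact (Submodule.finrank_mono this).trans ((finrank_span_le_card _).trans (by simp))

theorem SimpleGraph.Connected.eq_of_forall_dart {V α : Type*} {G : SimpleGraph V}
    (hG : G.Connected) {x : V → α} (h : ∀ d : G.Dart, x d.fst = x d.snd) (v w : V) :
    x v = x w := by
  obtain ⟨p⟩ := hG.preconnected v w
  induction p with
  | nil => rfl
  | cons hvw _ ih => exact (h ⟨(_, _), hvw⟩).trans ih

theorem SimpleGraph.Dart.sum_edge_fiber {V M : Type*} {G : SimpleGraph V} [Fintype G.Dart]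
    [DecidableEq V] [AddCommMonoid M] (x : G.Dart → M) (d : G.Dart) :
    (∑ d' : G.Dart, if d'.edge = d.edge then x d' else 0) = x d + x d.symm := by
  have h : ∀ d' : G.Dart, d'.edge = d.edge ↔ d' ∈ ({d, d.symm} : Finset G.Dart) := fun d' => by
    simpa using SimpleGraph.dart_edge_eq_iff d' d
  simp only [h, Finset.sum_ite_mem, Finset.univ_inter]
  exact Finset.sum_pair d.symm_ne.symm

namespace PlaneGraph

variable {V : Type*} {G : SimpleGraph V} {P : PlaneGraph G}

/-- A plane graph with even faces is bipartite: by Euler's formula, every cochain modulo two that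
vanishes on the boundaries of the faces is a coboundary. -/
theorem HasEvenPolygonalFaces.nonempty_coloring_bool [Finite V] (hP : P.HasEvenPolygonalFaces) :
    Nonempty (G.Coloring Bool) := by
  classical
  have := Fintype.ofFinite V
  have := Fintype.ofFinite P.toMap.Face
  let ed : G.Dart → G.edgeSet := fun d => ⟨d.edge, d.edge_mem⟩
  let B := incidenceMatrix ed fun d : G.Dart => d.fst
  let A := incidenceMatrix P.toMap.face ed
  have hed : ∀ e, ∃ d, ed d = e := by
    rintro ⟨⟨u, v⟩, h⟩
    exact ⟨⟨(u, v), h⟩, rfl⟩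
  have hB : ∀ x d, B.mulVec x (ed d) = x d.fst + x d.snd := fun x d => by
    rw [incidenceMatrix_mulVec]
    simp only [ed, Subtype.mk.injEq]
    exact SimpleGraph.Dart.sum_edge_fiber (fun d => x d.fst) d
  have hAt : ∀ z d, A.transpose.mulVec z (ed d) =
      z (P.toMap.face d) + z (P.toMap.face d.symm) := fun z d => by
    rw [incidenceMatrix_transpose, incidenceMatrix_mulVec]
    simp only [ed, Subtype.mk.injEq]
    exact SimpleGraph.Dart.sum_edge_fiber (fun d => z (P.toMap.face d)) d
  have hkerB : Module.finrank (ZMod 2) (LinearMap.ker B.mulVecLin) ≤ 1 := by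
    refine finrank_le_one_of_forall_const fun x hx => P.connected.eq_of_forall_dart fun d => ?_
    rw [← CharTwo.add_eq_zero, ← hB]
    exact congrFun hx (ed d)
  have hkerAt : Module.finrank (ZMod 2) (LinearMap.ker A.transpose.mulVecLin) ≤ 1 := by
    refine finrank_le_one_of_forall_const fun z hz => ?_
    have hsymm : ∀ d : G.Dart, z (P.toMap.face d) = z (P.toMap.face d.symm) := fun d => by
      rw [← CharTwo.add_eq_zero, ← hAt]
      exact congrFun hz (ed d)
    -- Crossing edges around a vertex visits all of its faces, so `z` descends to a function on
    -- vertices, constant by connectedness.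
    have hrot : ∀ d : G.Dart, z (P.toMap.face (P.rot d)) = z (P.toMap.face d) := fun d => by
      have h1 : P.toMap.facePerm (P.rot d).symm = d := P.rot.symm_apply_apply d
      rw [hsymm, ← P.toMap.face_facePerm (P.rot d).symm, h1]
    choose dart hdart using P.exists_dart
    have hvert : ∀ d : G.Dart, z (P.toMap.face (dart d.fst)) = z (P.toMap.face d) := fun d =>
      (P.rot_cyclic (dart d.fst) d (hdart _)).apply_eq_of_invariant
        (g := fun d => z (P.toMap.face d)) hrot
    intro f f'
    obtain ⟨d, rfl⟩ := P.toMap.face_surjective f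
    obtain ⟨d', rfl⟩ := P.toMap.face_surjective f'
    rw [← hvert d, ← hvert d']
    refine P.connected.eq_of_forall_dart (x := fun v => z (P.toMap.face (dart v))) (fun d => ?_) _ _
    exact (hvert d).trans ((hsymm d).trans (hvert d.symm).symm)
  have hle : LinearMap.range B.mulVecLin ≤ LinearMap.ker A.mulVecLin := by
    rintro _ ⟨x, rfl⟩
    refine funext fun f => ?_
    change A.mulVec (B.mulVec x) f = 0
    rw [incidenceMatrix_mulVec]
    have hshift : (∑ d, if P.toMap.face d = f then x d.snd else 0) =
        ∑ d, if P.toMap.face d = f then x d.fst else 0 := by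
      rw [← Equiv.sum_comp P.toMap.facePerm fun d => if P.toMap.face d = f then x d.fst else 0]
      simp only [CombMap.face_facePerm, facePerm_fst]
    simp only [hB, ite_add_zero, Finset.sum_add_distrib]
    rw [hshift]
    exact CharTwo.add_self_eq_zero _
  -- Here rank `B` ≥ |V| - 1, while dim ker `A` = |E| - rank `A` ≤ |E| - |F| + 1 = |V| - 1 by
  -- Euler's formula.
  have heq : LinearMap.range B.mulVecLin = LinearMap.ker A.mulVecLin := by
    refine Submodule.eq_of_le_of_finrank_le hle ?_
    have h1 := B.rank_add_finrank_ker_mulVecLin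
    have h2 := A.rank_add_finrank_ker_mulVecLin
    have h3 := A.transpose.rank_add_finrank_ker_mulVecLin
    have h4 : Nat.card V + Nat.card P.toMap.Face = Nat.card G.edgeSet + 2 := P.euler
    rw [Matrix.rank_transpose] at h3
    simp only [Nat.card_eq_fintype_card] at h4
    rw [Matrix.rank] at h1
    omega
  -- On each face the constant cochain 1 sums to the length of the boundary, which is even. A
  -- potential `x` for it changes along every edge.
  have hone : (fun _ => 1) ∈ LinearMap.ker A.mulVecLin := by
    refine funext fun f => ?_
    change A.mulVec (fun _ => 1) f = 0
    rw [incidenceMatrix_mulVec, Finset.sum_boole, ZMod.natCast_eq_zero_iff_even]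
    convert hP.even_ncard f
    rw [← Set.ncard_coe_finset]
    simp
  rw [← heq] at hone
  obtain ⟨x, hx⟩ := hone
  refine ⟨SimpleGraph.Coloring.mk (fun v => decide (x v = 0)) fun {v w} hvw h => ?_⟩
  have h1 : x v + x w = 1 :=
    (hB x ⟨(v, w), hvw⟩).symm.trans (congrFun hx (ed ⟨(v, w), hvw⟩))
  revert h h1
  generalize x v = a
  generalize x w = b
  revert a b
  decide

end PlaneGraph

theorem mainTheorem2 {V : Type*} [Finite V] (G : SimpleGraph V) (P : PlaneGraph G)
    (hP : P.HasEvenPolygonalFaces) :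
    IsGreatest P.halfMonochromaticNumbers P.chiF ∧
    IsGreatest P.dividingRegionNumbers P.maxRegions ∧
    P.chiF = P.maxRegions := by
  obtain ⟨β⟩ := hP.nonempty_coloring_bool
  have hsub := hP.dividingRegionNumbers_subset β
  have hbdd := P.bddAbove_halfMonochromaticNumbers
  have hbdd' := hbdd.mono hsub
  have hχ : P.chiF ∈ P.halfMonochromaticNumbers :=
    Nat.sSup_mem ⟨2, hP.two_mem_halfMonochromaticNumbers β⟩ hbdd
  obtain ⟨r, hr, hle⟩ := hP.exists_le_dividingRegionNumbers hχ
  have hmax : P.maxRegions ∈ P.dividingRegionNumbers := Nat.sSup_mem ⟨r, hr⟩ hbdd'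
  exact ⟨⟨hχ, fun _ h => le_csSup hbdd h⟩, ⟨hmax, fun _ h => le_csSup hbdd' h⟩,
    le_antisymm (hle.trans (le_csSup hbdd' hr)) (le_csSup hbdd (hsub hmax))⟩
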